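/- Let $k$ be a field and let $C\subset\mathbb P^4_k$ be a curve, i.e. a closed subscheme of dimension $1$, of degree $8$ and arithmetic genus $4$; that is, the Hilbert polynomial of $C$ is $8n+1-4$. Suppose that $C$ is arithmetically Cohen–Macaulay (ACM): its homogeneous coordinate ring $k[x_0,\dots,x_4]/I(C)$ is a Cohen–Macaulay ring, where $I(C)$ is the homogeneous ideal generated by all forms vanishing on $C$. Let $\mathcal I_C\subset\mathcal O_{\mathbb P^4_k}$ be the ideal sheaf of $C$. Then $$h^0\bigl(\mathbb P^4_k,\mathcal I_C(2)\bigr)=\dim_k H^0\bigl(\mathbb P^4_k,\mathcal I_C(2)\bigr)=2.$$ In particular, $C$ is contained (as a subscheme) in a quadric hypersurface: there is a nonzero quadratic form $q\in k[x_0,\dots,x_4]$ such that $C$ is a closed subscheme of the hypersurface $V(q)\subset\mathbb P^4_k$. -/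

import Mathlib

open AlgebraicGeometry CategoryTheory MvPolynomial

noncomputable section

namespace ACMCurve

universe u

attribute [local instance] MvPolynomial.gradedAlgebra

/-! ### Cohen-Macaulay rings -/

/-- A Noetherian local ring is Cohen-Macaulay if its maximal ideal contains a regular sequence
whose length is the Krull dimension of the ring (that is, depth equals dimension). -/
structure IsCohenMacaulayLocalRing (R : Type u) [CommRing R] [IsLocalRing R] : Prop where
  noetherian : IsNoetherianRing R
  exists_regular : ∃ rs : List R, (∀ r ∈ rs, r ∈ IsLocalRing.maximalIdeal R) ∧
    RingTheory.Sequence.IsRegular R rs ∧ ((rs.length : ℕ) : WithBot ℕ∞) = ringKrullDim R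

/-- A Noetherian ring is Cohen-Macaulay if its localization at every maximal ideal is. -/
structure IsCohenMacaulayRing (R : Type u) [CommRing R] : Prop where
  noetherian : IsNoetherianRing R
  localization : ∀ (m : Ideal R) [m.IsMaximal], IsCohenMacaulayLocalRing (Localization.AtPrime m)

/-! ### Projective space and twisted ideal sheaves -/

/-- Projective space of dimension `r` over `k`, i.e. `Proj k[x₀, …, x_r]` with the standard
grading. -/
abbrev ProjSpace (r : ℕ) (k : Type u) [Field k] : Scheme.{u} :=
  Proj (homogeneousSubmodule (Fin (r + 1)) k)

variable {r : ℕ} {k : Type u} [Field k]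

/-- The homogeneous prime ideal of a point of projective space. -/
abbrev primeAt (y : ProjSpace r k) : Ideal (MvPolynomial (Fin (r + 1)) k) :=
  (ProjectiveSpectrum.asHomogeneousIdeal
    (𝒜 := homogeneousSubmodule (Fin (r + 1)) k) y).toIdeal

instance isPrime_primeAt (y : ProjSpace r k) : (primeAt y).IsPrime :=
  ProjectiveSpectrum.isPrime (𝒜 := homogeneousSubmodule (Fin (r + 1)) k) y

/-- The localization `k[x₀, …, x_r]_𝔭` at the homogeneous prime `𝔭` of a point of
projective space. The stalk of `𝒪(n)` at the point is its part of degree `n`. -/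
abbrev LocAt (y : ProjSpace r k) : Type u :=
  Localization.AtPrime (primeAt y)

/-- The standard affine open `D₊(x_i)`. -/
abbrev chart (r : ℕ) (k : Type u) [Field k] (i : Fin (r + 1)) : (ProjSpace r k).Opens :=
  Proj.basicOpen (homogeneousSubmodule (Fin (r + 1)) k) (X i)

/-- The value of a section of the structure sheaf at a point, as an element of the (degree zero
part of the) localization `k[x₀, …, x_r]_𝔭`. -/
def valueAt {U : (ProjSpace r k).Opens} (y : ProjSpace r k) (hy : y ∈ U) :
    Γ(ProjSpace r k, U) →+* LocAt y :=
  (algebraMap (HomogeneousLocalization.AtPrime (homogeneousSubmodule (Fin (r + 1)) k) (primeAt y))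
    (LocAt y)).comp
    (openToLocalization (homogeneousSubmodule (Fin (r + 1)) k) U y hy).hom

/-- The constant section with value `c` has value `c` at every point. -/
lemma valueAt_const (i : Fin (r + 1)) (c : k)
    (hc : (C c : MvPolynomial (Fin (r + 1)) k) ∈ homogeneousSubmodule (Fin (r + 1)) k 0)
    (y : ProjSpace r k) (hy : y ∈ chart r k i) :
    valueAt y hy ((Proj.awayToSection (homogeneousSubmodule (Fin (r + 1)) k) (X i)).hom
      (HomogeneousLocalization.fromZeroRingHom _ _ ⟨C c, hc⟩)) =
    algebraMap (MvPolynomial (Fin (r + 1)) k) (LocAt y) (C c) := by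
  exact Localization.mk_one_eq_algebraMap (M := (primeAt y).primeCompl) _

/-- The sections over `U` of the ideal sheaf of `ι : Z ⟶ ℙ^r`, the kernel of
`𝒪_{ℙ^r} → ι_* 𝒪_Z`. -/
def idealSections {Z : Scheme.{u}} (ι : Z ⟶ ProjSpace r k) (U : (ProjSpace r k).Opens) :
    Ideal Γ(ProjSpace r k, U) :=
  RingHom.ker (ι.app U).hom

/-- `H⁰(ℙ^r, ℐ_Z(n))` as a `k`-vector space. As in the description of the structure sheaf of
`Proj`, a section of `𝒪(n)` is a family `s` of elements of the localizations at the points.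
On `D₊(x_i)` the sheaf `𝒪(n)` is free on `x_i ^ n`, so that `ℐ_Z(n)` is `ℐ_Z · x_i ^ n` there. -/
def twistedIdealSections {Z : Scheme.{u}} (ι : Z ⟶ ProjSpace r k) (n : ℕ) :
    Submodule k (∀ y : ProjSpace r k, LocAt y) where
  carrier := {s | ∀ i, ∃ t ∈ idealSections ι (chart r k i), ∀ y (hy : y ∈ chart r k i),
    s y = valueAt y hy t * algebraMap (MvPolynomial (Fin (r + 1)) k) (LocAt y) (X i ^ n)}
  zero_mem' := by
    intro i
    refine ⟨0, zero_mem _, fun y hy => ?_⟩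
    simp
  add_mem' := by
    intro s s' hs hs' i
    obtain ⟨t, ht, h⟩ := hs i
    obtain ⟨t', ht', h'⟩ := hs' i
    refine ⟨t + t', add_mem ht ht', fun y hy => ?_⟩
    rw [Pi.add_apply, h y hy, h' y hy, map_add, add_mul]
  smul_mem' := by
    intro c s hs i
    obtain ⟨t, ht, h⟩ := hs i
    have hc : (C c : MvPolynomial (Fin (r + 1)) k) ∈ homogeneousSubmodule (Fin (r + 1)) k 0 :=
      isHomogeneous_C _ _
    refine ⟨(Proj.awayToSection _ (X i)).hom
      (HomogeneousLocalization.fromZeroRingHom _ _ ⟨C c, hc⟩) * t,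
      Ideal.mul_mem_left _ _ ht, fun y hy => ?_⟩
    rw [Pi.smul_apply, h y hy, map_mul, valueAt_const, mul_assoc, ← Algebra.smul_def,
      ← algebraMap_eq, algebraMap_smul]

/-- `h⁰(ℐ_Z(n))`. -/
def h0TwistedIdeal {Z : Scheme.{u}} (ι : Z ⟶ ProjSpace r k) (n : ℕ) : ℕ :=
  Module.finrank k (twistedIdealSections ι n)

/-! ### Homogeneous coordinate ring, Hilbert polynomial, curves -/

/-- A form `f` of degree `n`, regarded as a global section of `𝒪(n)`, lies in `ℐ_Z(n)`;
in other words, `f` vanishes on the subscheme `Z`. -/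
def VanishesOn {Z : Scheme.{u}} (ι : Z ⟶ ProjSpace r k) (n : ℕ)
    (f : MvPolynomial (Fin (r + 1)) k) : Prop :=
  (fun y => algebraMap (MvPolynomial (Fin (r + 1)) k) (LocAt y) f) ∈ twistedIdealSections ι n

/-- The (saturated) homogeneous ideal of `Z` in `k[x₀, …, x_r]`, generated by all forms that
vanish on `Z`. -/
def homogeneousIdealOf {Z : Scheme.{u}} (ι : Z ⟶ ProjSpace r k) :
    Ideal (MvPolynomial (Fin (r + 1)) k) :=
  Ideal.span {f | ∃ n, f ∈ homogeneousSubmodule (Fin (r + 1)) k n ∧ VanishesOn ι n f}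

/-- The homogeneous coordinate ring of `Z`. -/
abbrev CoordinateRing {Z : Scheme.{u}} (ι : Z ⟶ ProjSpace r k) : Type u :=
  MvPolynomial (Fin (r + 1)) k ⧸ homogeneousIdealOf ι

/-- `Z` is arithmetically Cohen-Macaulay: its homogeneous coordinate ring is Cohen-Macaulay. -/
def IsACM {Z : Scheme.{u}} (ι : Z ⟶ ProjSpace r k) : Prop :=
  IsCohenMacaulayRing (CoordinateRing ι)

/-- The Hilbert function: the dimension of the degree `n` part of the coordinate ring. -/
def hilbertFunction {Z : Scheme.{u}} (ι : Z ⟶ ProjSpace r k) (n : ℕ) : ℕ :=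
  Module.finrank k ((homogeneousSubmodule (Fin (r + 1)) k n).map
    (Ideal.Quotient.mkₐ k (homogeneousIdealOf ι)).toLinearMap)

/-- `P` is the Hilbert polynomial of `Z`. -/
def IsHilbertPolynomial {Z : Scheme.{u}} (ι : Z ⟶ ProjSpace r k) (P : Polynomial ℚ) : Prop :=
  ∀ᶠ n : ℕ in Filter.atTop, P.eval (n : ℚ) = hilbertFunction ι n

/-- `ι : Z ⟶ ℙ^r` is a curve (a closed subscheme of dimension one) of degree `d` and arithmetic
genus `g`: its Hilbert polynomial is `d n + 1 - g`. -/
structure IsCurve {Z : Scheme.{u}} (ι : Z ⟶ ProjSpace r k) (d : ℕ) (g : ℤ) : Prop where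
  isClosedImmersion : IsClosedImmersion ι
  dim_eq_one : topologicalKrullDim Z = 1
  hilbertPolynomial : IsHilbertPolynomial ι
    (Polynomial.C (d : ℚ) * Polynomial.X + Polynomial.C (1 - (g : ℚ)))

/-! ### Hypersurfaces -/

/-- The ideal sheaf of the hypersurface `V(q)` of a form `q` of degree `d`: the smallest
quasi-coherent ideal sheaf `J` such that `q` is a section of `J(d)`. So `V(q)` is the largest
closed subscheme on which `q` vanishes. -/
def hypersurface (d : ℕ) (q : MvPolynomial (Fin (r + 1)) k) : (ProjSpace r k).IdealSheafData :=
  sInf {J | VanishesOn J.subschemeι d q}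

/-- `Z` is contained, as a subscheme, in a hypersurface of degree `d`: the morphism `ι` factors
through `V(q)` for some nonzero form `q` of degree `d`. -/
def LiesOnHypersurface {Z : Scheme.{u}} (ι : Z ⟶ ProjSpace r k) (d : ℕ) : Prop :=
  ∃ q ∈ homogeneousSubmodule (Fin (r + 1)) k d, q ≠ 0 ∧
    ∃ j : Z ⟶ (hypersurface d q).subscheme, j ≫ (hypersurface d q).subschemeι = ι

end ACMCurve

end

/-
Since `C` has dimension one, the irrelevant ideal of its coordinate ring `S` has height at least
two, so the Cohen-Macaulay hypothesis makes its depth at least two. After extending `k` to an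
infinite field, two general linear forms `ℓ, ℓ'` are therefore a regular sequence on `S`, and the
exact sequence `0 → Sₙ → Sₙ₊₁² → Sₙ₊₂` given by `(-ℓ', ℓ)` and `(ℓ, ℓ')` shows that the Hilbert
function `H` is convex. Subtracting the Hilbert polynomial `d n + 1 - g` leaves a convex function
that is eventually zero, hence antitone and nonnegative. In degree one it is nonpositive as soon as
`r + 1 ≤ d + 1 - g`, because `H 1 ≤ r + 1`; so `H n = d n + 1 - g` for all `n ≥ 1`. Finally the
global sections of `ℐ_C(n)` are the forms of degree `n` in the homogeneous ideal of `C`, whence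
`h⁰(ℐ_C(n)) = (r + n).choose n - H n`.
-/

noncomputable section

namespace ACMCurve

universe u

section GradedRing

variable {k A : Type*} [CommRing k] [CommRing A] [Algebra k A] {ι : Type*} [DecidableEq ι]
  (𝒜 : ι → Submodule k A)

theorem exists_mem_eq_mul_of_dvd [AddRightCancelMonoid ι] [GradedAlgebra 𝒜] {i j : ι} {a b : A}
    (ha : a ∈ 𝒜 j) (hb : b ∈ 𝒜 (i + j)) (h : a ∣ b) : ∃ c ∈ 𝒜 i, b = a * c := by
  obtain ⟨c, rfl⟩ := h
  rw [mul_comm] at hb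
  refine ⟨DirectSum.decompose 𝒜 c i, SetLike.coe_mem _, ?_⟩
  rw [mul_comm a c, mul_comm a, ← DirectSum.coe_decompose_mul_add_of_right_mem 𝒜 ha,
    DirectSum.decompose_of_mem_same 𝒜 hb]

variable {𝒜} [AddMonoid ι] [GradedAlgebra 𝒜]

theorem decompose_mem_of_mem_span_iUnion {V : ι → Submodule k A} (hV : ∀ i, V i ≤ 𝒜 i)
    (hmul : ∀ {i j : ι} {a b : A}, a ∈ 𝒜 i → b ∈ V j → a * b ∈ V (i + j)) {f : A}
    (hf : f ∈ Ideal.span (⋃ i, (V i : Set A))) (i : ι) :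
    (DirectSum.decompose 𝒜 f i : A) ∈ V i := by
  have of_mem {j : ι} {b : A} (hb : b ∈ V j) (i : ι) : (DirectSum.decompose 𝒜 b i : A) ∈ V i := by
    obtain rfl | hij := eq_or_ne j i
    · rwa [DirectSum.decompose_of_mem_same 𝒜 (hV j hb)]
    · rw [DirectSum.decompose_of_mem_ne 𝒜 (hV j hb) hij]
      exact zero_mem _
  have of_add {b c : A} (hb : ∀ i, (DirectSum.decompose 𝒜 b i : A) ∈ V i)
      (hc : ∀ i, (DirectSum.decompose 𝒜 c i : A) ∈ V i) (i : ι) :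
      (DirectSum.decompose 𝒜 (b + c) i : A) ∈ V i := by
    rw [DirectSum.decompose_add]
    exact add_mem (hb i) (hc i)
  induction hf using Submodule.span_induction generalizing i with
  | mem f h =>
    obtain ⟨j, hj⟩ := Set.mem_iUnion.1 h
    exact of_mem hj i
  | zero => simp
  | add f g _ _ hf hg => exact of_add hf hg i
  | smul a f _ hf =>
    classical
    rw [smul_eq_mul, ← DirectSum.sum_support_decompose 𝒜 a,
      ← DirectSum.sum_support_decompose 𝒜 f, Finset.sum_mul_sum]
    revert i
    exact Finset.sum_induction _ (fun b => ∀ i, (DirectSum.decompose 𝒜 b i : A) ∈ V i)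
      (fun _ _ => of_add) (by simp) fun j _ =>
        Finset.sum_induction _ (fun b => ∀ i, (DirectSum.decompose 𝒜 b i : A) ∈ V i)
          (fun _ _ => of_add) (by simp) fun l _ => of_mem (hmul (SetLike.coe_mem _) (hf l))

end GradedRing

section KoszulDepth

variable {A : Type*} [CommRing A] {σ : Type*}

open RingTheory.Sequence in
theorem isWeaklyRegular_pair_iff {a b : A} :
    IsWeaklyRegular A [a, b] ↔ IsSMulRegular A a ∧ ∀ c, a ∣ b * c → a ∣ c := by
  have mk_eq_zero (c : A) : (Submodule.Quotient.mk c : QuotSMulTop a A) = 0 ↔ a ∣ c := by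
    rw [Submodule.Quotient.mk_eq_zero, Submodule.mem_smul_pointwise_iff_exists]
    simp [dvd_def, eq_comm]
  simp only [isWeaklyRegular_cons_iff, isSMulRegular_iff_right_eq_zero_of_smul,
    (Submodule.Quotient.mk_surjective _).forall, ← Submodule.Quotient.mk_smul, mk_eq_zero,
    smul_eq_mul, IsWeaklyRegular.nil, and_true]

/-- The Koszul complex of the family `x` is exact in its first two positions,
`0 → A → (σ → A) → (σ × σ → A)`: this is the part of the depth of the ideal generated by `x`
being at least two that passes to flat extensions and descends from localizations. -/
structure KoszulDepthTwo (x : σ → A) : Prop where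
  eq_zero : ∀ a : A, a • x = 0 → a = 0
  exists_eq_smul : ∀ c : σ → A, (∀ i j, x j * c i = x i * c j) → ∃ b : A, c = b • x

variable {x c : σ → A} {a s : A}

theorem mul_eq_zero_of_mem_span (ha : a • x = 0) (hs : s ∈ Ideal.span (Set.range x)) :
    s * a = 0 := by
  have : Ideal.span (Set.range x) ≤ (Ideal.span {a}).annihilator := by
    rw [Ideal.span_le]
    rintro _ ⟨i, rfl⟩
    rw [SetLike.mem_coe, Submodule.mem_annihilator_span_singleton, smul_eq_mul, mul_comm]
    exact congrFun ha i
  exact (Submodule.mem_annihilator_span_singleton _ _).1 (this hs)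

theorem exists_smul_eq_smul_of_mem_span (hc : ∀ i j, x j * c i = x i * c j)
    (hs : s ∈ Ideal.span (Set.range x)) : ∃ b : A, s • c = b • x := by
  have : Ideal.span (Set.range x) ≤
      (Submodule.span A {x}).comap (LinearMap.toSpanSingleton A (σ → A) c) := by
    rw [Ideal.span_le]
    rintro _ ⟨j, rfl⟩
    refine Submodule.mem_span_singleton.2 ⟨c j, funext fun i => ?_⟩
    simp [hc i j, mul_comm]
  obtain ⟨b, hb⟩ := Submodule.mem_span_singleton.1 (this hs)
  exact ⟨b, hb.symm⟩

namespace KoszulDepthTwo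

theorem of_isWeaklyRegular {s : A} (ha : a ∈ Ideal.span (Set.range x))
    (hs : s ∈ Ideal.span (Set.range x)) (h : RingTheory.Sequence.IsWeaklyRegular A [a, s]) :
    KoszulDepthTwo x := by
  obtain ⟨ha_reg, hs_reg⟩ := isWeaklyRegular_pair_iff.1 h
  have eq_zero (b : A) (hb : b • x = 0) : b = 0 :=
    ha_reg.right_eq_zero_of_smul (mul_eq_zero_of_mem_span hb ha)
  refine ⟨eq_zero, fun c hc => ?_⟩
  obtain ⟨b, hb⟩ := exists_smul_eq_smul_of_mem_span hc ha
  obtain ⟨b', hb'⟩ := exists_smul_eq_smul_of_mem_span hc hs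
  have hbb' : s * b = a * b' := sub_eq_zero.1 <| eq_zero _ <| by
    rw [sub_smul, mul_smul, mul_smul, ← hb, ← hb', smul_comm, sub_self]
  obtain ⟨e, rfl⟩ := hs_reg b ⟨b', hbb'⟩
  exact ⟨e, IsSMulRegular.pi (fun _ => ha_reg) (by simpa only [mul_smul] using hb)⟩

theorem of_isLocalization [Finite σ] (m : Ideal A) [m.IsMaximal]
    (hm : m ≤ Ideal.span (Set.range x)) (B : Type*) [CommRing B] [Algebra A B]
    [IsLocalization.AtPrime B m] (h : KoszulDepthTwo fun i => algebraMap A B (x i)) :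
    KoszulDepthTwo x where
  eq_zero a ha := by
    have := h.eq_zero (algebraMap A B a) <| funext fun i => by
      simpa using congrArg (algebraMap A B) (congrFun ha i)
    obtain ⟨s, hs⟩ := (IsLocalization.map_eq_zero_iff m.primeCompl B a).1 this
    obtain ⟨t, w, hw, ht⟩ := Ideal.IsMaximal.exists_inv ‹m.IsMaximal› s.2
    linear_combination (-a) * ht + t * hs + mul_eq_zero_of_mem_span ha (hm hw)
  exists_eq_smul c hc := by
    obtain ⟨b, hb⟩ := h.exists_eq_smul (fun i => algebraMap A B (c i)) fun i j => by
      simp only [← map_mul, hc i j]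
    obtain ⟨⟨b, s⟩, rfl⟩ := IsLocalization.mk'_surjective m.primeCompl b
    have hcb (i : σ) : ∃ w : m.primeCompl, w.1 * (s.1 * c i) = w.1 * (b * x i) := by
      refine (IsLocalization.eq_iff_exists m.primeCompl B).1 ?_
      rw [map_mul, map_mul, congrFun hb i, Pi.smul_apply, smul_eq_mul, ← mul_assoc,
        IsLocalization.mk'_spec']
    choose w hw using hcb
    have := Fintype.ofFinite σ
    obtain ⟨t, v, hv, ht⟩ := Ideal.IsMaximal.exists_inv ‹m.IsMaximal› (((∏ i, w i) * s).2)
    obtain ⟨b', hb'⟩ := exists_smul_eq_smul_of_mem_span hc (hm hv)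
    refine ⟨t * (∏ i, w i : m.primeCompl) * b + b', funext fun i => ?_⟩
    obtain ⟨u, hu⟩ := Finset.dvd_prod_of_mem w (Finset.mem_univ i)
    have hu' : ((∏ i, w i : m.primeCompl) : A) = (w i) * u := by rw [hu]; rfl
    have hb'i : v * c i = b' * x i := congrFun hb' i
    simp only [Submonoid.coe_mul, hu', Pi.smul_apply, smul_eq_mul] at ht ⊢
    linear_combination (- c i) * ht + t * u * hw i + hb'i

theorem map_of_free [Finite σ] (h : KoszulDepthTwo x) (B : Type*) [CommRing B] [Algebra A B]
    [Module.Free A B] : KoszulDepthTwo fun i => algebraMap A B (x i) := by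
  let e := Module.Free.chooseBasis A B
  have repr_mul (i : σ) (a : B) : e.repr (algebraMap A B (x i) * a) = x i • e.repr a := by
    rw [← Algebra.smul_def, map_smul]
  refine ⟨fun a ha => ?_, fun c hc => ?_⟩
  · refine e.repr.map_eq_zero_iff.1 <| Finsupp.ext fun κ => h.eq_zero _ <| funext fun i => ?_
    have := congrArg (fun v => e.repr v κ) (congrFun ha i)
    rw [Pi.smul_apply, smul_eq_mul, mul_comm, repr_mul] at this
    simpa [mul_comm] using this
  · have (κ : _) : ∃ b, (fun i => e.repr (c i) κ) = b • x := h.exists_eq_smul _ fun i j => by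
      simpa [repr_mul] using congrArg (fun v => e.repr v κ) (hc i j)
    choose b hb using this
    have hfin : (Function.support b).Finite := by
      refine (Set.finite_iUnion fun i => (e.repr (c i)).hasFiniteSupport).subset fun κ hκ => ?_
      by_contra hκ'
      refine hκ (h.eq_zero _ ?_)
      simpa [← hb, funext_iff] using hκ'
    refine ⟨e.repr.symm (Finsupp.ofSupportFinite b hfin), funext fun i => e.repr.injective ?_⟩
    ext κ
    rw [Pi.smul_apply, smul_eq_mul, mul_comm, repr_mul, LinearEquiv.apply_symm_apply,
      Finsupp.smul_apply, Finsupp.ofSupportFinite_coe, smul_eq_mul, mul_comm]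
    exact congrFun (hb κ) i

end KoszulDepthTwo

theorem exists_mem_span_isSMulRegular {k : Type*} [Field k] [Infinite k] [Algebra k A]
    [IsNoetherianRing A] {M : Type*} [AddCommGroup M] [Module A M] [Module.Finite A M]
    (hx : ∀ m : M, (∀ i, x i • m = 0) → m = 0) :
    ∃ ℓ ∈ Submodule.span k (Set.range x), IsSMulRegular M ℓ := by
  set V := Submodule.span k (Set.range x)
  have : Finite (associatedPrimes A M) := associatedPrimes.finite A M
  obtain ⟨ℓ, hℓ⟩ := Submodule.exists_forall_notMem_of_forall_ne_top
    (fun p : associatedPrimes A M => ((p.1.restrictScalars k).comap V.subtype)) fun p htop => by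
      obtain ⟨hp, m, hm⟩ := isAssociatedPrime_iff.1 p.2
      refine hp.ne_top ?_
      have hm0 : m = 0 := hx m fun i => by
        have : x i ∈ p.1 := Submodule.comap_subtype_eq_top.1 htop
          (Submodule.subset_span ⟨i, rfl⟩)
        rwa [hm, Submodule.mem_colon_singleton, Submodule.mem_bot] at this
      simp [hm, hm0]
  refine ⟨ℓ, ℓ.2, ?_⟩
  by_contra hreg
  have : (ℓ : A) ∈ {a : A | IsSMulRegular M a}ᶜ := hreg
  rw [← biUnion_associatedPrimes_eq_compl_regular, Set.mem_iUnion₂] at this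
  obtain ⟨p, hp, hℓp⟩ := this
  exact hℓ ⟨p, hp⟩ hℓp

theorem KoszulDepthTwo.exists_isWeaklyRegular (h : KoszulDepthTwo x) (k : Type*) [Field k]
    [Infinite k] [Algebra k A] [IsNoetherianRing A] :
    ∃ ℓ ∈ Submodule.span k (Set.range x), ∃ ℓ' ∈ Submodule.span k (Set.range x),
      RingTheory.Sequence.IsWeaklyRegular A [ℓ, ℓ'] := by
  obtain ⟨ℓ, hℓ, hreg⟩ := exists_mem_span_isSMulRegular (k := k) (M := A) (x := x)
    fun a ha => h.eq_zero a <| funext fun i => by simpa [mul_comm] using ha i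
  obtain ⟨ℓ', hℓ', hreg'⟩ := exists_mem_span_isSMulRegular (k := k) (M := A ⧸ Ideal.span {ℓ})
    (x := x) fun m hm => by
      obtain ⟨a, rfl⟩ := Ideal.Quotient.mk_surjective m
      have (i : σ) : ∃ c, x i * a = ℓ * c := by
        have := hm i
        rwa [← Ideal.Quotient.mk_eq_mk, ← Submodule.Quotient.mk_smul, Ideal.Quotient.mk_eq_mk,
          Ideal.Quotient.eq_zero_iff_dvd] at this
      choose c hc using this
      obtain ⟨b, rfl⟩ := h.exists_eq_smul c fun i j => hreg <| by
        simp only [smul_eq_mul]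
        linear_combination x i * hc j - x j * hc i
      rw [Ideal.Quotient.eq_zero_iff_dvd]
      refine ⟨b, sub_eq_zero.1 <| h.eq_zero _ <| funext fun i => ?_⟩
      simp only [Pi.smul_apply, smul_eq_mul, Pi.zero_apply] at hc ⊢
      linear_combination hc i
  refine ⟨ℓ, hℓ, ℓ', hℓ', isWeaklyRegular_pair_iff.2 ⟨hreg, fun a ha => ?_⟩⟩
  rw [← Ideal.Quotient.eq_zero_iff_dvd] at ha ⊢
  exact hreg'.right_eq_zero_of_smul (by simpa [Algebra.smul_def] using ha)

end KoszulDepth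

section Convexity

open TensorProduct

variable {k A : Type*} [Field k] [CommRing A] [Algebra k A] {σ : Type*} {x : σ → A}

attribute [local instance] Algebra.TensorProduct.rightAlgebra in
theorem KoszulDepthTwo.baseChange [Finite σ] (h : KoszulDepthTwo x) (K : Type*) [Field K]
    [Algebra k K] : KoszulDepthTwo fun i => (1 : K) ⊗ₜ[k] x i := by
  have : Module.Free A (K ⊗[k] A) :=
    .of_equiv (Algebra.TensorProduct.commRight k A K).toLinearEquiv
  exact h.map_of_free (K ⊗[k] A)

variable (𝒜 : ℕ → Submodule k A) [GradedAlgebra 𝒜]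

/-- Multiplication by a form `ℓ` of degree one, as a map from the forms of degree `n` to the forms
of degree `n + 1`. -/
def mulLinearForm {ℓ : A} (hℓ : ℓ ∈ 𝒜 1) (n : ℕ) : 𝒜 n →ₗ[k] 𝒜 (n + 1) :=
  (LinearMap.mulLeft k ℓ).restrict fun _ ha => add_comm 1 n ▸ SetLike.mul_mem_graded hℓ ha

theorem two_mul_finrank_le_of_isWeaklyRegular [∀ n, Module.Finite k (𝒜 n)] {ℓ ℓ' : A}
    (hℓ : ℓ ∈ 𝒜 1) (hℓ' : ℓ' ∈ 𝒜 1) (h : RingTheory.Sequence.IsWeaklyRegular A [ℓ, ℓ'])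
    (n : ℕ) :
    2 * Module.finrank k (𝒜 (n + 1)) ≤
      Module.finrank k (𝒜 (n + 2)) + Module.finrank k (𝒜 n) := by
  obtain ⟨hreg, hreg'⟩ := isWeaklyRegular_pair_iff.1 h
  let φ := (mulLinearForm 𝒜 hℓ (n + 1)).coprod (mulLinearForm 𝒜 hℓ' (n + 1))
  let ψ := (-mulLinearForm 𝒜 hℓ' n).prod (mulLinearForm 𝒜 hℓ n)
  have ker_le_range : φ.ker ≤ ψ.range := by
    rintro ⟨a, a'⟩ haa'
    have hφ : ℓ * a + ℓ' * a' = 0 := congrArg Subtype.val haa'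
    obtain ⟨b, hb, hab⟩ := exists_mem_eq_mul_of_dvd 𝒜 hℓ a'.2
      (hreg' a' ⟨-a, by linear_combination hφ⟩)
    refine ⟨⟨b, hb⟩, Prod.ext (Subtype.ext (hreg ?_)) (Subtype.ext hab.symm)⟩
    change ℓ * -(ℓ' * b) = ℓ * a
    linear_combination ℓ' * hab - hφ
  calc 2 * Module.finrank k (𝒜 (n + 1))
      = Module.finrank k (𝒜 (n + 1) × 𝒜 (n + 1)) := by rw [Module.finrank_prod, two_mul]
    _ = Module.finrank k φ.range + Module.finrank k φ.ker :=
      φ.finrank_range_add_finrank_ker.symm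
    _ ≤ Module.finrank k (𝒜 (n + 2)) + Module.finrank k (𝒜 n) :=
      add_le_add φ.range.finrank_le
        ((Submodule.finrank_mono ker_le_range).trans ψ.finrank_range_le)

theorem finrank_baseChange_submodule (K : Type*) [Field K] [Algebra k K] (V : Submodule k A) :
    Module.finrank K (V.baseChange K) = Module.finrank k V := by
  rw [← (Submodule.toBaseChange.toLinearEquiv K V).finrank_eq, Module.finrank_baseChange]

theorem two_mul_finrank_le [Finite σ] [Algebra.FiniteType k A] [∀ n, Module.Finite k (𝒜 n)]
    (hx : ∀ i, x i ∈ 𝒜 1) (h : KoszulDepthTwo x) (n : ℕ) :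
    2 * Module.finrank k (𝒜 (n + 1)) ≤
      Module.finrank k (𝒜 (n + 2)) + Module.finrank k (𝒜 n) := by
  let K := AlgebraicClosure k
  let 𝒜' : ℕ → Submodule K (K ⊗[k] A) := fun n => (𝒜 n).baseChange K
  have : IsNoetherianRing (K ⊗[k] A) := Algebra.FiniteType.isNoetherianRing K _
  have (n : ℕ) : Module.Finite K (𝒜' n) :=
    Module.Finite.equiv (Submodule.toBaseChange.toLinearEquiv K (𝒜 n))
  have span_le : Submodule.span K (Set.range fun i => (1 : K) ⊗ₜ[k] x i) ≤ 𝒜' 1 := by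
    rw [Submodule.span_le]
    rintro _ ⟨i, rfl⟩
    exact Submodule.tmul_mem_baseChange_of_mem (1 : K) (hx i)
  obtain ⟨ℓ, hℓ, ℓ', hℓ', hreg⟩ := (h.baseChange (k := k) K).exists_isWeaklyRegular K
  simpa only [𝒜', finrank_baseChange_submodule] using
    two_mul_finrank_le_of_isWeaklyRegular 𝒜' (span_le hℓ) (span_le hℓ') hreg n

end Convexity

section QuotientGrading

variable {k A : Type*} [CommRing k] [CommRing A] [Algebra k A] {ι : Type*} [DecidableEq ι]
  (𝒜 : ι → Submodule k A) (I : Ideal A)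

/-- The images in `A ⧸ I` of the homogeneous parts of `A`. They grade `A ⧸ I` when `I` is
homogeneous. -/
abbrev quotientGrading (i : ι) : Submodule k (A ⧸ I) :=
  (𝒜 i).map (Ideal.Quotient.mkₐ k I).toLinearMap

variable [AddMonoid ι] [GradedAlgebra 𝒜]

instance quotientGrading.gradedMonoid : SetLike.GradedMonoid (quotientGrading 𝒜 I) where
  one_mem := ⟨1, SetLike.one_mem_graded 𝒜, map_one (Ideal.Quotient.mk I)⟩
  mul_mem := by
    rintro _ _ _ _ ⟨a, ha, rfl⟩ ⟨b, hb, rfl⟩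
    exact ⟨a * b, SetLike.mul_mem_graded ha hb, map_mul (Ideal.Quotient.mk I) a b⟩

variable {I}

theorem isInternal_quotientGrading (hI : I.IsHomogeneous 𝒜) :
    DirectSum.IsInternal (quotientGrading 𝒜 I) := by
  refine DirectSum.isInternal_submodule_of_iSupIndep_of_iSup_eq_top ?_ ?_
  · rw [iSupIndep_iff_finsetSum_eq_zero_imp_eq_zero]
    intro s v hv hsum i hi
    choose! a ha hav using hv
    have sum_mem : ∑ j ∈ s, a j ∈ I := by
      rw [← Ideal.Quotient.eq_zero_iff_mem, map_sum, ← hsum]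
      exact Finset.sum_congr rfl hav
    have component_eq : (DirectSum.decompose 𝒜 (∑ j ∈ s, a j) i : A) = a i := by
      rw [DirectSum.decompose_sum, DFinsupp.finsetSum_apply, AddSubmonoidClass.coe_finsetSum,
        Finset.sum_eq_single_of_mem i hi fun j hj hji =>
          DirectSum.decompose_of_mem_ne 𝒜 (ha j hj) hji,
        DirectSum.decompose_of_mem_same 𝒜 (ha i hi)]
    rw [← hav i hi]
    exact Ideal.Quotient.eq_zero_iff_mem.2 (component_eq ▸ hI i sum_mem)
  · rw [← Submodule.map_iSup, (DirectSum.Decomposition.isInternal 𝒜).submodule_iSup_eq_top,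
      Submodule.map_top, LinearMap.range_eq_top]
    exact Ideal.Quotient.mk_surjective

/-- The quotient of a graded algebra by a homogeneous ideal is graded. Not an instance, as
homogeneity is a hypothesis. -/
abbrev gradedAlgebraQuotientGrading (hI : I.IsHomogeneous 𝒜) :
    GradedAlgebra (quotientGrading 𝒜 I) where
  __ := (isInternal_quotientGrading 𝒜 hI).chooseDecomposition

end QuotientGrading

theorem antitone_of_convex_of_eventually_eq_zero {e : ℕ → ℤ}
    (hconv : ∀ n, 2 * e (n + 1) ≤ e (n + 2) + e n) (hzero : ∀ᶠ n in Filter.atTop, e n = 0) :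
    Antitone e := by
  have hmono : Monotone fun n => e (n + 1) - e n :=
    monotone_nat_of_le_succ fun n => by linarith [hconv n]
  obtain ⟨N, hN⟩ := Filter.eventually_atTop.1 hzero
  refine antitone_nat_of_succ_le fun n => sub_nonpos.1 ?_
  calc e (n + 1) - e n ≤ e (max n N + 1) - e (max n N) := hmono (le_max_left n N)
    _ = 0 := by rw [hN _ (le_max_right n N), hN _ (by omega), sub_zero]

theorem finrank_map_add_finrank_inf_ker {K M N : Type*} [Field K] [AddCommGroup M] [Module K M]
    [AddCommGroup N] [Module K N] (φ : M →ₗ[K] N) (V : Submodule K M) [FiniteDimensional K V] :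
    Module.finrank K (V.map φ) + Module.finrank K ↥(V ⊓ φ.ker) = Module.finrank K V := by
  rw [← (φ.domRestrict V).finrank_range_add_finrank_ker, LinearMap.range_domRestrict,
    LinearMap.ker_domRestrict, ← Submodule.map_comap_subtype, Submodule.finrank_map_subtype_eq]

attribute [local instance] MvPolynomial.gradedAlgebra

section Forms

variable {σ R : Type*} [CommRing R]

theorem ker_constantCoeff_eq_idealOfVars :
    RingHom.ker (constantCoeff : MvPolynomial σ R →+* R) = idealOfVars σ R := by
  ext f
  rw [← pow_one (idealOfVars σ R), mem_pow_idealOfVars_iff', RingHom.mem_ker, constantCoeff_eq]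
  refine ⟨fun h d hd => ?_, fun h => h 0 (by simp)⟩
  rwa [(Finsupp.degree_eq_zero_iff d).1 (Nat.lt_one_iff.1 hd)]

theorem X_pow_dvd_of_mem_homogeneousSubmodule [Subsingleton σ] (i : σ) {m n : ℕ} (hmn : m ≤ n)
    {f : MvPolynomial σ R} (hf : f ∈ homogeneousSubmodule σ R n) : X i ^ m ∣ f := by
  have hmem : f ∈ Ideal.span (Set.range X) ^ m := (mem_pow_idealOfVars_iff' m f).2 fun d hd =>
    IsHomogeneous.coeff_eq_zero hf (hd.trans_le hmn).ne
  let := uniqueOfSubsingleton i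
  rw [Set.range_unique, Ideal.span_singleton_pow, Ideal.mem_span_singleton] at hmem
  exact hmem

theorem exists_form_of_compatible [IsDomain R] [Nonempty σ] {n : ℕ} {N : σ → ℕ}
    {a : σ → MvPolynomial σ R} (ha : ∀ i, a i ∈ homogeneousSubmodule σ R (n + N i))
    (h : ∀ i j, a i * X j ^ N j = a j * X i ^ N i) :
    ∃ f ∈ homogeneousSubmodule σ R n, ∀ i, a i = X i ^ N i * f := by
  have hdvd (i : σ) : X i ^ N i ∣ a i := by
    cases subsingleton_or_nontrivial σ with
    | inl _ => exact X_pow_dvd_of_mem_homogeneousSubmodule i (Nat.le_add_left _ _) (ha i)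
    | inr _ =>
      obtain ⟨j, hji⟩ := exists_ne i
      have not_dvd : ¬ (X i : MvPolynomial σ R) ∣ X j ^ N j := fun hd =>
        hji (X_dvd_X.1 (X_prime.dvd_of_dvd_pow hd)).symm
      exact X_prime.pow_dvd_of_dvd_mul_right _ not_dvd ⟨a j, by rw [h i j, mul_comm]⟩
  choose f hf haf using fun i =>
    exists_mem_eq_mul_of_dvd (homogeneousSubmodule σ R) (isHomogeneous_X_pow i (N i)) (ha i)
      (hdvd i)
  obtain ⟨i₀⟩ := ‹Nonempty σ›
  refine ⟨f i₀, hf i₀, fun i => ?_⟩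
  refine mul_right_cancel₀ (pow_ne_zero (N i₀) (X_ne_zero i₀)) ?_
  rw [h i i₀, haf i₀]
  ring

variable (R) (n : ℕ)

/-- The monomials of degree `n`, as a basis of the forms of degree `n`. -/
def homogeneousSubmoduleBasis [Fintype σ] [DecidableEq σ] :
    Module.Basis ((Finset.univ : Finset σ).finsuppAntidiag n) R (homogeneousSubmodule σ R n) :=
  ((basisRestrictSupport R {d : σ →₀ ℕ | d.degree = n}).map
    (LinearEquiv.ofEq _ _ (homogeneousSubmodule_eq_finsupp_supported σ R n).symm)).reindex
    (Equiv.subtypeEquivRight fun d => by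
      simp [Finset.mem_finsuppAntidiag, Finsupp.degree_eq_sum])

instance finite_homogeneousSubmodule [Finite σ] :
    Module.Finite R (homogeneousSubmodule σ R n) := by
  classical
  have := Fintype.ofFinite σ
  exact .of_basis (homogeneousSubmoduleBasis R n)

theorem finrank_homogeneousSubmodule [Nontrivial R] (r : ℕ) :
    Module.finrank R (homogeneousSubmodule (Fin (r + 1)) R n) = (r + n).choose n := by
  rw [Module.finrank_eq_card_basis (homogeneousSubmoduleBasis R n), Fintype.card_coe,
    Finset.card_finsuppAntidiag_nat_eq_choose, Finset.card_univ, Fintype.card_fin,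
    Nat.add_right_comm, Nat.add_sub_cancel]

end Forms

section Points

variable {r : ℕ} {k : Type u} [Field k]

theorem irrelevant_le_idealOfVars (σ R : Type*) [CommRing R] :
    (HomogeneousIdeal.irrelevant (homogeneousSubmodule σ R)).toIdeal ≤ idealOfVars σ R := by
  intro f hf
  rw [← ker_constantCoeff_eq_idealOfVars, RingHom.mem_ker, constantCoeff_eq]
  have : homogeneousComponent 0 f = 0 :=
    (decomposition.decompose'_apply f 0).symm.trans ((HomogeneousIdeal.mem_irrelevant_iff _ f).1 hf)
  rwa [homogeneousComponent_zero, C_eq_zero] at this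

theorem le_idealOfVars_of_isHomogeneous {σ K : Type*} [Field K] {I : Ideal (MvPolynomial σ K)}
    (hI : I.IsHomogeneous (homogeneousSubmodule σ K)) (hI' : I ≠ ⊤) : I ≤ idealOfVars σ K := by
  intro f hf
  rw [← ker_constantCoeff_eq_idealOfVars, RingHom.mem_ker, constantCoeff_eq]
  by_contra h0
  have hmem := homogeneousComponent_mem_of_mem hI hf 0
  rw [homogeneousComponent_zero] at hmem
  exact hI' (Ideal.eq_top_of_isUnit_mem _ hmem ((isUnit_iff_ne_zero.2 h0).map C))

instance isMaximal_idealOfVars (σ K : Type*) [Field K] : (idealOfVars σ K).IsMaximal :=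
  ker_constantCoeff_eq_idealOfVars (σ := σ) (R := K) ▸
    RingHom.ker_isMaximal_of_surjective _ fun c => ⟨C c, constantCoeff_C _ c⟩

theorem exists_mem_chart (y : ProjSpace r k) : ∃ i, y ∈ chart r k i := by
  have := Proj.iSup_basicOpen_eq_top (homogeneousSubmodule (Fin (r + 1)) k) X
    (irrelevant_le_idealOfVars _ k)
  exact TopologicalSpace.Opens.mem_iSup.1 (this ▸ TopologicalSpace.Opens.mem_top y)

end Points

section ChartSections

variable {r : ℕ} {k : Type u} [Field k] {i : Fin (r + 1)} {y : ProjSpace r k}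

/-- The value at `y` of a polynomial, as an element of `k[x₀, …, x_r]_𝔭`. For a form of degree `n`
this is its value as a section of `𝒪(n)`. -/
abbrev evalAt (y : ProjSpace r k) : MvPolynomial (Fin (r + 1)) k →+* LocAt y :=
  algebraMap (MvPolynomial (Fin (r + 1)) k) (LocAt y)

theorem isUnit_evalAt {f : MvPolynomial (Fin (r + 1)) k} (hf : f ∉ primeAt y) :
    IsUnit (evalAt y f) :=
  IsLocalization.map_units (M := (primeAt y).primeCompl) (LocAt y) ⟨f, hf⟩

theorem valueAt_awayMk_mul_X_pow (n : ℕ) (a : MvPolynomial (Fin (r + 1)) k)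
    (ha : a ∈ homogeneousSubmodule (Fin (r + 1)) k (n • 1)) (hy : y ∈ chart r k i) :
    valueAt y hy ((Proj.awayToSection (homogeneousSubmodule (Fin (r + 1)) k) (X i)).hom
      (HomogeneousLocalization.Away.mk _ (isHomogeneous_X k i) n a ha)) *
        evalAt y (X i ^ n) =
      evalAt y a := by
  have hn : X i ^ n ∈ (primeAt y).primeCompl := Submonoid.pow_mem _ hy n
  change Localization.mk a ⟨X i ^ n, hn⟩ * _ = _
  rw [Localization.mk_eq_mk'_apply]
  exact IsLocalization.mk'_spec (LocAt y) a ⟨X i ^ n, hn⟩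

theorem exists_section_of_form (i : Fin (r + 1)) {n : ℕ} {a : MvPolynomial (Fin (r + 1)) k}
    (ha : a ∈ homogeneousSubmodule (Fin (r + 1)) k n) :
    ∃ t : Γ(ProjSpace r k, chart r k i), ∀ y (hy : y ∈ chart r k i),
      valueAt y hy t * evalAt y (X i ^ n) = evalAt y a :=
  ⟨_, fun _ => valueAt_awayMk_mul_X_pow n a (by rwa [smul_eq_mul, mul_one])⟩

theorem exists_form_of_section (t : Γ(ProjSpace r k, chart r k i)) :
    ∃ n, ∃ a ∈ homogeneousSubmodule (Fin (r + 1)) k n, ∀ y (hy : y ∈ chart r k i),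
      valueAt y hy t * evalAt y (X i ^ n) = evalAt y a := by
  let e := Proj.basicOpenIsoAway (homogeneousSubmodule (Fin (r + 1)) k) (X i)
    (isHomogeneous_X k i) one_pos
  obtain ⟨n, a, ha, h⟩ := HomogeneousLocalization.Away.mk_surjective _
    (isHomogeneous_X k i) (e.inv t)
  obtain rfl : e.hom (HomogeneousLocalization.Away.mk _ (isHomogeneous_X k i) n a ha) = t :=
    h ▸ e.inv_hom_id_apply t
  exact ⟨n, a, by rwa [smul_eq_mul, mul_one] at ha, fun _ => valueAt_awayMk_mul_X_pow n a ha⟩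

theorem isUnit_germ_of_isUnit_valueAt {U : (ProjSpace r k).Opens} (hy : y ∈ U)
    {t : Γ(ProjSpace r k, U)} (ht : IsUnit (valueAt y hy t)) :
    IsUnit ((ProjSpace r k).presheaf.germ U y hy t) := by
  have hval := (HomogeneousLocalization.isUnit_iff_isUnit_val
    (homogeneousSubmodule (Fin (r + 1)) k) (primeAt y) _).1 ht
  refine (MulEquiv.isUnit_map (Proj.stalkIso' _ y)).1 ?_
  exact (Proj.stalkIso'_germ (homogeneousSubmodule (Fin (r + 1)) k) U y hy t).symm ▸ hval

theorem not_isUnit_valueAt {Z : Scheme.{u}} {ι : Z ⟶ ProjSpace r k} {U : (ProjSpace r k).Opens}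
    {t : Γ(ProjSpace r k, U)} (ht : t ∈ idealSections ι U) {z : Z} (hz : ι z ∈ U) :
    ¬ IsUnit (valueAt (ι z) hz t) := by
  intro hu
  have hmem : z ∈ ι ⁻¹ᵁ (ProjSpace r k).basicOpen t :=
    (Scheme.mem_basicOpen _ _ _ hz).2 (isUnit_germ_of_isUnit_valueAt hz hu)
  have happ : (ι.app U) t = 0 := ht
  rw [Scheme.preimage_basicOpen, happ, Scheme.basicOpen_zero] at hmem
  exact hmem

end ChartSections

section VanishingForms

variable {r : ℕ} {k : Type u} [Field k] {Z : Scheme.{u}} {ι : Z ⟶ ProjSpace r k} {m n : ℕ}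
  {f g : MvPolynomial (Fin (r + 1)) k}

/-- A polynomial as the family of its values at the points of projective space. On forms of degree
`n` this is the map to the global sections of `𝒪(n)`, in the encoding of `twistedIdealSections`. -/
def formEval (r : ℕ) (k : Type u) [Field k] :
    MvPolynomial (Fin (r + 1)) k →ₗ[k] ∀ y : ProjSpace r k, LocAt y :=
  (Algebra.linearMap (MvPolynomial (Fin (r + 1)) k)
    (∀ y : ProjSpace r k, LocAt y)).restrictScalars k

/-- The forms of degree `n` that vanish on `Z`. -/
def formsVanishingOn (ι : Z ⟶ ProjSpace r k) (n : ℕ) :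
    Submodule k (MvPolynomial (Fin (r + 1)) k) :=
  homogeneousSubmodule (Fin (r + 1)) k n ⊓ (twistedIdealSections ι n).comap (formEval r k)

theorem VanishesOn.mul (hg : g ∈ homogeneousSubmodule (Fin (r + 1)) k m)
    (hf : VanishesOn ι n f) : VanishesOn ι (m + n) (g * f) := by
  intro i
  obtain ⟨t, ht, hft⟩ := hf i
  obtain ⟨t', hgt'⟩ := exists_section_of_form i hg
  refine ⟨t' * t, Ideal.mul_mem_left _ _ ht, fun y hy => ?_⟩
  calc evalAt y (g * f) = evalAt y g * evalAt y f := map_mul _ _ _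
    _ = valueAt y hy t' * evalAt y (X i ^ m) * (valueAt y hy t * evalAt y (X i ^ n)) := by
      rw [hgt' y hy]
      exact congrArg _ (hft y hy)
    _ = valueAt y hy (t' * t) * evalAt y (X i ^ (m + n)) := by
      rw [pow_add, map_mul, map_mul]
      ring

theorem homogeneousIdealOf_eq_span_iUnion (ι : Z ⟶ ProjSpace r k) :
    homogeneousIdealOf ι =
      Ideal.span (⋃ n, (formsVanishingOn ι n : Set (MvPolynomial (Fin (r + 1)) k))) := by
  rw [homogeneousIdealOf]
  congr 1
  ext f
  rw [Set.mem_iUnion]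
  rfl

theorem decompose_mem_formsVanishingOn (hf : f ∈ homogeneousIdealOf ι) (n : ℕ) :
    (DirectSum.decompose (homogeneousSubmodule (Fin (r + 1)) k) f n :
      MvPolynomial (Fin (r + 1)) k) ∈ formsVanishingOn ι n := by
  rw [homogeneousIdealOf_eq_span_iUnion] at hf
  refine decompose_mem_of_mem_span_iUnion (fun _ => inf_le_left) (fun ha hb => ?_) hf n
  exact ⟨SetLike.mul_mem_graded ha hb.1, VanishesOn.mul ha hb.2⟩

theorem formsVanishingOn_eq_inf (ι : Z ⟶ ProjSpace r k) (n : ℕ) :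
    formsVanishingOn ι n =
      homogeneousSubmodule (Fin (r + 1)) k n ⊓ (homogeneousIdealOf ι).restrictScalars k := by
  refine le_antisymm (fun f hf => ⟨hf.1, Ideal.subset_span ⟨n, hf⟩⟩) fun f ⟨hf, hfI⟩ => ?_
  rw [← DirectSum.decompose_of_mem_same (homogeneousSubmodule (Fin (r + 1)) k) hf]
  exact decompose_mem_formsVanishingOn hfI n

theorem isHomogeneous_homogeneousIdealOf (ι : Z ⟶ ProjSpace r k) :
    (homogeneousIdealOf ι).IsHomogeneous (homogeneousSubmodule (Fin (r + 1)) k) :=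
  fun n _ hf => Ideal.subset_span ⟨n, decompose_mem_formsVanishingOn hf n⟩

theorem VanishesOn.mem_primeAt (hf : VanishesOn ι n f) (z : Z) : f ∈ primeAt (ι z) := by
  obtain ⟨i, hi⟩ := exists_mem_chart (ι z)
  obtain ⟨t, ht, hft⟩ := hf i
  by_contra hfz
  refine not_isUnit_valueAt ht hi (isUnit_of_mul_isUnit_left (y := evalAt (ι z) (X i ^ n)) ?_)
  exact hft (ι z) hi ▸ isUnit_evalAt hfz

theorem homogeneousIdealOf_le_primeAt (ι : Z ⟶ ProjSpace r k) (z : Z) :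
    homogeneousIdealOf ι ≤ primeAt (ι z) :=
  Ideal.span_le.2 fun _ ⟨_, _, hf⟩ => hf.mem_primeAt z

end VanishingForms

section GlobalSections

variable {r : ℕ} {k : Type u} [Field k] {Z : Scheme.{u}} {ι : Z ⟶ ProjSpace r k} {n : ℕ}

/-- The generic point of projective space. -/
def genericPt (r : ℕ) (k : Type u) [Field k] : ProjSpace r k where
  asHomogeneousIdeal := ⊥
  isPrime := HomogeneousIdeal.toIdeal_bot (𝒜 := homogeneousSubmodule (Fin (r + 1)) k) ▸
    Ideal.isPrime_bot
  not_irrelevant_le h := X_ne_zero (R := k) (0 : Fin (r + 1)) <| (Submodule.mem_bot _).1 <|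
    h (HomogeneousIdeal.mem_irrelevant_of_mem _ one_pos (isHomogeneous_X k 0))

theorem primeAt_genericPt : primeAt (genericPt r k) = ⊥ := HomogeneousIdeal.toIdeal_bot

theorem genericPt_mem_chart (i : Fin (r + 1)) : genericPt r k ∈ chart r k i := by
  change X i ∉ primeAt (genericPt r k)
  rw [primeAt_genericPt]
  exact X_ne_zero i

theorem evalAt_genericPt_injective : Function.Injective (evalAt (genericPt r k)) := by
  refine IsLocalization.injective _ (M := (primeAt (genericPt r k)).primeCompl) ?_
  intro f hf
  refine mem_nonZeroDivisors_of_ne_zero ?_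
  rintro rfl
  exact hf (zero_mem _)

theorem formEval_injective : Function.Injective (formEval r k) := fun _ _ h =>
  evalAt_genericPt_injective (congrFun h (genericPt r k))

theorem exists_form_on_chart {s : ∀ y : ProjSpace r k, LocAt y}
    (hs : s ∈ twistedIdealSections ι n) (i : Fin (r + 1)) :
    ∃ N, ∃ a ∈ homogeneousSubmodule (Fin (r + 1)) k (n + N), ∀ y ∈ chart r k i,
      s y * evalAt y (X i ^ N) = evalAt y a := by
  obtain ⟨t, -, hst⟩ := hs i
  obtain ⟨N, a, ha, hta⟩ := exists_form_of_section t
  refine ⟨N, X i ^ n * a, SetLike.mul_mem_graded (isHomogeneous_X_pow i n) ha, fun y hy => ?_⟩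
  rw [hst y hy, map_mul _ _ a, ← hta y hy]
  ring

theorem exists_form_of_mem_twistedIdealSections {s : ∀ y : ProjSpace r k, LocAt y}
    (hs : s ∈ twistedIdealSections ι n) :
    ∃ f ∈ homogeneousSubmodule (Fin (r + 1)) k n, formEval r k f = s := by
  choose N a ha hsa using exists_form_on_chart hs
  have compatible (i j : Fin (r + 1)) : a i * X j ^ N j = a j * X i ^ N i := by
    refine evalAt_genericPt_injective ?_
    rw [map_mul, map_mul, ← hsa i _ (genericPt_mem_chart i), ← hsa j _ (genericPt_mem_chart j)]
    ring
  obtain ⟨f, hf, haf⟩ := exists_form_of_compatible ha compatible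
  refine ⟨f, hf, funext fun y => ?_⟩
  obtain ⟨i, hi⟩ := exists_mem_chart y
  refine ((isUnit_evalAt hi).pow (N i)).mul_right_cancel ?_
  rw [← map_pow, hsa i y hi, haf i, map_mul, mul_comm]
  rfl

theorem twistedIdealSections_eq_map (ι : Z ⟶ ProjSpace r k) (n : ℕ) :
    twistedIdealSections ι n = (formsVanishingOn ι n).map (formEval r k) := by
  refine le_antisymm (fun s hs => ?_) (Submodule.map_le_iff_le_comap.2 inf_le_right)
  obtain ⟨f, hf, rfl⟩ := exists_form_of_mem_twistedIdealSections hs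
  exact Submodule.mem_map_of_mem ⟨hf, hs⟩

theorem h0TwistedIdeal_eq_finrank_formsVanishingOn (ι : Z ⟶ ProjSpace r k) (n : ℕ) :
    h0TwistedIdeal ι n = Module.finrank k (formsVanishingOn ι n) := by
  rw [h0TwistedIdeal, twistedIdealSections_eq_map]
  exact (Submodule.equivMapOfInjective _ formEval_injective _).finrank_eq.symm

theorem hilbertFunction_add_h0TwistedIdeal (ι : Z ⟶ ProjSpace r k) (n : ℕ) :
    hilbertFunction ι n + h0TwistedIdeal ι n = (r + n).choose n := by
  have ideal_eq_ker : (homogeneousIdealOf ι).restrictScalars k =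
      (Ideal.Quotient.mkₐ k (homogeneousIdealOf ι)).toLinearMap.ker := by
    ext f
    exact Ideal.Quotient.eq_zero_iff_mem.symm
  rw [h0TwistedIdeal_eq_finrank_formsVanishingOn, formsVanishingOn_eq_inf, ideal_eq_ker,
    hilbertFunction, finrank_map_add_finrank_inf_ker, finrank_homogeneousSubmodule]

end GlobalSections

section Depth

variable {r : ℕ} {k : Type u} [Field k] {Z : Scheme.{u}}

theorem exists_specializes_of_topologicalKrullDim_eq_one {T : Type*} [TopologicalSpace T]
    [QuasiSober T] (h : topologicalKrullDim T = 1) : ∃ z w : T, z ⤳ w ∧ z ≠ w := by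
  obtain ⟨l, hl⟩ := Order.le_krullDim_iff.1
    (show ((1 : ℕ) : WithBot ℕ∞) ≤ Order.krullDim (TopologicalSpace.IrreducibleCloseds T)
      from h.symm.le)
  have hlt : l 0 < l (Fin.last _) := l.strictMono (Fin.lt_def.2 (by simp [hl]))
  obtain ⟨z, hz⟩ := QuasiSober.sober (l (Fin.last _)).isIrreducible (l (Fin.last _)).isClosed
  obtain ⟨w, hw⟩ := QuasiSober.sober (l 0).isIrreducible (l 0).isClosed
  refine ⟨z, w, specializes_iff_mem_closure.2 (hz.def ▸ hlt.le hw.mem), ?_⟩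
  rintro rfl
  exact hlt.ne (TopologicalSpace.IrreducibleCloseds.ext (hw.def.symm.trans hz.def))

theorem primeAt_lt_primeAt {x y : ProjSpace r k} (h : x ⤳ y) (hne : x ≠ y) :
    primeAt x < primeAt y :=
  lt_of_le_of_ne
    ((ProjectiveSpectrum.le_iff_mem_closure _ x y).2 (specializes_iff_mem_closure.1 h))
    fun heq => hne (ProjectiveSpectrum.ext (HomogeneousIdeal.toIdeal_injective heq))

theorem primeAt_lt_idealOfVars (y : ProjSpace r k) : primeAt y < idealOfVars (Fin (r + 1)) k := by
  refine lt_of_le_of_ne (le_idealOfVars_of_isHomogeneous y.asHomogeneousIdeal.isHomogeneous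
    (isPrime_primeAt y).ne_top) fun heq => ?_
  obtain ⟨i, hi⟩ := exists_mem_chart y
  refine hi (show X i ∈ primeAt y from ?_)
  exact heq ▸ Ideal.subset_span (Set.mem_range_self i)

theorem map_mk_lt_map_mk {R : Type*} [CommRing R] {I p q : Ideal R} (hI : I ≤ p) (h : p < q) :
    p.map (Ideal.Quotient.mk I) < q.map (Ideal.Quotient.mk I) := by
  refine lt_of_le_of_ne (Ideal.map_mono h.le) fun heq => h.ne ?_
  rw [← Ideal.comap_map_mk hI, heq, Ideal.comap_map_mk (hI.trans h.le)]

/-- The homogeneous coordinates of projective space, as elements of the coordinate ring of `Z`. -/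
abbrev coord (ι : Z ⟶ ProjSpace r k) (i : Fin (r + 1)) : CoordinateRing ι :=
  Ideal.Quotient.mk _ (X i)

/-- The irrelevant ideal of the coordinate ring of `Z`. -/
abbrev irrelevantIdeal (ι : Z ⟶ ProjSpace r k) : Ideal (CoordinateRing ι) :=
  (idealOfVars (Fin (r + 1)) k).map (Ideal.Quotient.mk (homogeneousIdealOf ι))

theorem irrelevantIdeal_eq_span (ι : Z ⟶ ProjSpace r k) :
    irrelevantIdeal ι = Ideal.span (Set.range (coord ι)) := by
  rw [irrelevantIdeal, Ideal.map_span, ← Set.range_comp]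
  rfl

theorem isMaximal_irrelevantIdeal [Nonempty Z] (ι : Z ⟶ ProjSpace r k) :
    (irrelevantIdeal ι).IsMaximal := by
  refine Ideal.IsMaximal.map_of_surjective_of_ker_le Ideal.Quotient.mk_surjective ?_
  rw [Ideal.mk_ker]
  exact (homogeneousIdealOf_le_primeAt ι (Classical.arbitrary Z)).trans
    (primeAt_lt_idealOfVars _).le

theorem two_le_height_irrelevantIdeal (ι : Z ⟶ ProjSpace r k) [IsClosedImmersion ι]
    (h : topologicalKrullDim Z = 1) : 2 ≤ (irrelevantIdeal ι).height := by
  obtain ⟨z, w, hzw, hne⟩ := exists_specializes_of_topologicalKrullDim_eq_one h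
  have : Nonempty Z := ⟨z⟩
  have := isMaximal_irrelevantIdeal ι
  let p (v : Z) : Ideal (CoordinateRing ι) :=
    (primeAt (ι v)).map (Ideal.Quotient.mk (homogeneousIdealOf ι))
  have isPrime_p (v : Z) : (p v).IsPrime :=
    Ideal.map_isPrime_of_surjective Ideal.Quotient.mk_surjective
      (Ideal.mk_ker.trans_le (homogeneousIdealOf_le_primeAt ι v))
  have hzw' : p z < p w := map_mk_lt_map_mk (homogeneousIdealOf_le_primeAt ι z)
    (primeAt_lt_primeAt (hzw.map ι.continuous) (ι.isClosedEmbedding.injective.ne hne))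
  have hw : p w < irrelevantIdeal ι :=
    map_mk_lt_map_mk (homogeneousIdealOf_le_primeAt ι w) (primeAt_lt_idealOfVars _)
  calc (2 : ℕ∞) ≤ (p z).height + 1 + 1 := by rw [add_assoc, one_add_one_eq_two]; exact le_add_self
    _ ≤ (p w).height + 1 := by gcongr; exact Ideal.height_add_one_le_of_lt_of_isPrime hzw'
    _ ≤ (irrelevantIdeal ι).height := Ideal.height_add_one_le_of_lt_of_isPrime hw

theorem IsCohenMacaulayRing.exists_isWeaklyRegular_pair {R : Type u} [CommRing R]
    (hR : IsCohenMacaulayRing R) (m : Ideal R) [m.IsMaximal] (hm : 2 ≤ m.height) :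
    ∃ a ∈ IsLocalRing.maximalIdeal (Localization.AtPrime m),
      ∃ b ∈ IsLocalRing.maximalIdeal (Localization.AtPrime m),
        RingTheory.Sequence.IsWeaklyRegular (Localization.AtPrime m) [a, b] := by
  obtain ⟨-, rs, hrs, hreg, hlen⟩ := hR.localization m
  rw [IsLocalization.AtPrime.ringKrullDim_eq_height m] at hlen
  have two_le_length : 2 ≤ rs.length := by
    have : ((2 : ℕ∞) : WithBot ℕ∞) ≤ (rs.length : WithBot ℕ∞) := hlen ▸ WithBot.coe_le_coe.2 hm
    exact_mod_cast this
  match rs, two_le_length with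
  | a :: b :: rs, _ =>
    exact ⟨a, hrs a (by simp), b, hrs b (by simp),
      ((RingTheory.Sequence.isWeaklyRegular_append_iff _ [a, b] rs).1 hreg.toIsWeaklyRegular).1⟩

theorem IsACM.koszulDepthTwo {ι : Z ⟶ ProjSpace r k} [IsClosedImmersion ι] (hACM : IsACM ι)
    (h : topologicalKrullDim Z = 1) : KoszulDepthTwo (coord ι) := by
  obtain ⟨z, -⟩ := exists_specializes_of_topologicalKrullDim_eq_one h
  have : Nonempty Z := ⟨z⟩
  have := isMaximal_irrelevantIdeal ι
  obtain ⟨a, ha, b, hb, hab⟩ := IsCohenMacaulayRing.exists_isWeaklyRegular_pair hACM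
    (irrelevantIdeal ι) (two_le_height_irrelevantIdeal ι h)
  have maximalIdeal_eq_span :
      IsLocalRing.maximalIdeal (Localization.AtPrime (irrelevantIdeal ι)) =
        Ideal.span (Set.range fun i => algebraMap _ _ (coord ι i)) := by
    rw [← Localization.AtPrime.map_eq_maximalIdeal]
    refine (congrArg (Ideal.map _) (irrelevantIdeal_eq_span ι)).trans ?_
    rw [Ideal.map_span, ← Set.range_comp]
    rfl
  exact .of_isLocalization (irrelevantIdeal ι) (irrelevantIdeal_eq_span ι).le _
    (.of_isWeaklyRegular (maximalIdeal_eq_span ▸ ha) (maximalIdeal_eq_span ▸ hb) hab)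

end Depth

section HilbertFunction

variable {r : ℕ} {k : Type u} [Field k] {Z : Scheme.{u}} {ι : Z ⟶ ProjSpace r k} {d : ℕ} {g : ℤ}

theorem KoszulDepthTwo.two_mul_hilbertFunction_le (h : KoszulDepthTwo (coord ι)) (n : ℕ) :
    2 * hilbertFunction ι (n + 1) ≤ hilbertFunction ι (n + 2) + hilbertFunction ι n := by
  let 𝒜 := quotientGrading (homogeneousSubmodule (Fin (r + 1)) k) (homogeneousIdealOf ι)
  let : GradedAlgebra 𝒜 :=
    gradedAlgebraQuotientGrading _ (isHomogeneous_homogeneousIdealOf ι)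
  have (n : ℕ) : Module.Finite k (𝒜 n) := Module.Finite.map _ _
  exact two_mul_finrank_le 𝒜 (fun i => Submodule.mem_map_of_mem (isHomogeneous_X k i)) h n

theorem IsCurve.eventually_hilbertFunction_eq (hZ : IsCurve ι d g) :
    ∀ᶠ n : ℕ in Filter.atTop, (hilbertFunction ι n : ℤ) = d * n + 1 - g := by
  filter_upwards [hZ.hilbertPolynomial] with n hn
  simp only [Polynomial.eval_add, Polynomial.eval_mul, Polynomial.eval_C,
    Polynomial.eval_X] at hn
  have : (hilbertFunction ι n : ℚ) = d * n + 1 - g := by rw [← hn, add_sub_assoc]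
  exact_mod_cast this

theorem IsCurve.hilbertFunction_eq (hZ : IsCurve ι d g) (hACM : IsACM ι)
    (hdeg : (r : ℤ) + g ≤ d) {n : ℕ} (hn : 1 ≤ n) :
    (hilbertFunction ι n : ℤ) = d * n + 1 - g := by
  have := hZ.isClosedImmersion
  have hilbertFunction_one_le : hilbertFunction ι 1 ≤ r + 1 := by
    have := hilbertFunction_add_h0TwistedIdeal ι 1
    rw [Nat.choose_one_right] at this
    omega
  let e (m : ℕ) : ℤ := hilbertFunction ι m - (d * m + 1 - g)
  have eventually_eq_zero : ∀ᶠ m in Filter.atTop, e m = 0 :=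
    hZ.eventually_hilbertFunction_eq.mono fun m hm => sub_eq_zero.2 hm
  have antitone_e : Antitone e := by
    refine antitone_of_convex_of_eventually_eq_zero (fun m => ?_) eventually_eq_zero
    have := (hACM.koszulDepthTwo hZ.dim_eq_one).two_mul_hilbertFunction_le m
    dsimp only [e]
    push_cast
    linarith
  have e_nonneg : 0 ≤ e n := by
    obtain ⟨m, hm, hnm⟩ := (eventually_eq_zero.and (Filter.eventually_ge_atTop n)).exists
    exact hm ▸ antitone_e hnm
  have e_one_nonpos : e 1 ≤ 0 := by
    dsimp only [e]
    push_cast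
    linarith
  exact sub_eq_zero.1 (((antitone_e hn).trans e_one_nonpos).antisymm e_nonneg)

end HilbertFunction

section Hypersurface

variable {r : ℕ} {k : Type u} [Field k] {Z : Scheme.{u}} {ι : Z ⟶ ProjSpace r k} [QuasiCompact ι]
  {n : ℕ}

theorem VanishesOn.subschemeι_ker {f : MvPolynomial (Fin (r + 1)) k} (hf : VanishesOn ι n f) :
    VanishesOn ι.ker.subschemeι n f := by
  intro i
  obtain ⟨t, ht, hft⟩ := hf i
  refine ⟨t, ?_, hft⟩
  have isAffineOpen_chart : IsAffineOpen (chart r k i) :=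
    Proj.isAffineOpen_basicOpen _ _ (isHomogeneous_X k i) one_pos
  rwa [idealSections, ι.ker.ker_subschemeι_app ⟨chart r k i, isAffineOpen_chart⟩,
    Scheme.Hom.ker_apply]

theorem liesOnHypersurface_of_h0TwistedIdeal_ne_zero (h : h0TwistedIdeal ι n ≠ 0) :
    LiesOnHypersurface ι n := by
  have formsVanishingOn_ne_bot : formsVanishingOn ι n ≠ ⊥ := fun hbot => h <| by
    rw [h0TwistedIdeal_eq_finrank_formsVanishingOn, hbot, finrank_bot]
  obtain ⟨q, ⟨hq, hqZ⟩, hq0⟩ := Submodule.exists_mem_ne_zero_of_ne_bot formsVanishingOn_ne_bot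
  have hle : hypersurface n q ≤ ι.ker := sInf_le (VanishesOn.subschemeι_ker hqZ)
  refine ⟨q, hq, hq0, ι.toImage ≫ Scheme.IdealSheafData.inclusion hle, ?_⟩
  rw [Category.assoc, Scheme.IdealSheafData.inclusion_subschemeι, ι.toImage_imageι]

end Hypersurface

end ACMCurve

end

theorem mainTheorem10_general {r d n : ℕ} {g : ℤ} {k : Type*} [Field k] {C : Scheme}
    (ι : C ⟶ ACMCurve.ProjSpace r k) (hC : ACMCurve.IsCurve ι d g) (hACM : ACMCurve.IsACM ι)
    (hdeg : (r : ℤ) + g ≤ d) (hn : 1 ≤ n) :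
    (ACMCurve.h0TwistedIdeal ι n : ℤ) = (r + n).choose n - (d * n + 1 - g) ∧
      ((d * n + 1 - g : ℤ) < (r + n).choose n → ACMCurve.LiesOnHypersurface ι n) := by
  have := hC.isClosedImmersion
  have h0_eq : (ACMCurve.h0TwistedIdeal ι n : ℤ) = (r + n).choose n - (d * n + 1 - g) := by
    rw [← hC.hilbertFunction_eq hACM hdeg hn, ← ACMCurve.hilbertFunction_add_h0TwistedIdeal ι n]
    push_cast
    ring
  refine ⟨h0_eq, fun hlt => ACMCurve.liesOnHypersurface_of_h0TwistedIdeal_ne_zero ?_⟩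
  omega

theorem mainTheorem10 {k : Type*} [Field k] {C : Scheme} (ι : C ⟶ ACMCurve.ProjSpace 4 k)
    (hC : ACMCurve.IsCurve ι 8 4) (hACM : ACMCurve.IsACM ι) :
    ACMCurve.h0TwistedIdeal ι 2 = 2 ∧ ACMCurve.LiesOnHypersurface ι 2 := by
  have h := mainTheorem10_general ι hC hACM (by norm_num) one_le_two
  have choose_eq : (4 + 2).choose 2 = 15 := rfl
  exact ⟨by omega, h.2 (by norm_num [choose_eq])⟩
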